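/- For $\alpha>0$ let $K_\alpha$ be the integral operator on $L^2[0,\alpha]$ with the sine kernel, $(K_\alpha f)(x)=\int_0^\alpha \frac{\sin(x-y)}{\pi(x-y)}f(y)\,dy$. For $0<\beta<\pi$ let $\chi_\beta$ be the characteristic function of the subarc $\{e^{i\theta}:\beta<\theta<2\pi-\beta\}$ of the unit circle, and for an integrable function $a$ on the unit circle let $T_n(a)=(a_{j-k})_{j,k=0}^{n-1}$ be the $n\times n$ Toeplitz matrix of its Fourier coefficients $a_k=\frac1{2\pi}\int_0^{2\pi}a(e^{i\theta})e^{-ik\theta}\,d\theta$. Then for each $\alpha>0$ the operator $K_\alpha$ is trace class and $$\det(I-K_\alpha)=\lim_{n\to\infty}\det T_n(\chi_{\alpha/n}),$$ where the left-hand side is the operator (Fredholm) determinant, $\det(I+A)=\sum_{k\ge0}\operatorname{tr}\Lambda^k A$ for a trace class operator $A$. -/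

import Mathlib

open MeasureTheory

noncomputable section

namespace SineKernel

/-! ### Trace class operators and the operator determinant -/

section OperatorDeterminant

universe u

variable {H : Type u} [NormedAddCommGroup H] [InnerProductSpace ℂ H] [CompleteSpace H]

/-- A bounded operator `A` on a Hilbert space is trace class if `∑ᵢ ⟨eᵢ, |A| eᵢ⟩ < ∞` for every
orthonormal (Hilbert) basis `e`, where `|A| = (A* A)^{1/2}`. -/
def IsTraceClass (A : H →L[ℂ] H) : Prop :=
  ∀ (ι : Type u) (e : HilbertBasis ι ℂ H),
    Summable fun i : ι => RCLike.re (inner ℂ (e i) (CFC.abs A (e i)))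

open Classical in
/-- The principal minor `det (⟨eᵢ, A eⱼ⟩)_{i, j ∈ S}` of `A` in the orthonormal basis `e`.  It is the
diagonal matrix entry of the exterior power `Λᵏ A`, with `k = |S|`, at the basis vector
`⋀_{i ∈ S} eᵢ`. -/
def principalMinor {ι : Type u} (e : HilbertBasis ι ℂ H) (A : H →L[ℂ] H) (S : Finset ι) : ℂ :=
  Matrix.det (Matrix.of fun i j : S => inner ℂ (e i) (A (e j)))

/-- `HasOperatorDet B d` says that `B = I + A` with `A` trace class and that `d` is the operator
(Fredholm) determinant `det B = ∑ₖ tr (Λᵏ A)`.  The trace of `Λᵏ A` is the sum of the principal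
minors of `A` of size `k`, so that `d` is the (unconditionally convergent) sum of all principal
minors of `A`, in any orthonormal basis. -/
def HasOperatorDet (B : H →L[ℂ] H) (d : ℂ) : Prop :=
  IsTraceClass (B - 1) ∧
    ∀ (ι : Type u) (e : HilbertBasis ι ℂ H), HasSum (principalMinor e (B - 1)) d

/-- The operator determinant is unique. -/
theorem HasOperatorDet.unique {B : H →L[ℂ] H} {d d' : ℂ}
    (h : HasOperatorDet B d) (h' : HasOperatorDet B d') : d = d' := by
  obtain ⟨w, e, -⟩ := exists_hilbertBasis ℂ H
  exact (h.2 w e).unique (h'.2 w e)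

end OperatorDeterminant

/-! ### The sine kernel operator on `L²[0, α]` -/

/-- The sine kernel `k(x, y) = sin (x - y) / (π (x - y))`, with `k(x, x) = 1 / π`. -/
def sineKernel (x y : ℝ) : ℝ := Real.sinc (x - y) / Real.pi

theorem sineKernel_of_ne {x y : ℝ} (h : x ≠ y) :
    sineKernel x y = Real.sin (x - y) / (Real.pi * (x - y)) := by
  rw [sineKernel, Real.sinc_of_ne_zero (sub_ne_zero.mpr h), div_div, mul_comm]

theorem continuous_sineKernel : Continuous fun p : ℝ × ℝ => sineKernel p.1 p.2 := by
  unfold sineKernel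
  exact (Real.continuous_sinc.comp (continuous_fst.sub continuous_snd)).div_const _

theorem abs_sineKernel_le (x y : ℝ) : |sineKernel x y| ≤ 1 := by
  rw [sineKernel, abs_div, abs_of_pos Real.pi_pos, div_le_one Real.pi_pos]
  have := Real.abs_sinc_le_one (x - y)
  linarith [Real.pi_gt_three]

/-- Lebesgue measure on `[0, α]`. -/
abbrev vol (α : ℝ) : Measure ℝ := volume.restrict (Set.Icc 0 α)

/-- The complex Hilbert space `L²[0, α]`. -/
abbrev L2 (α : ℝ) : Type := Lp ℂ 2 (vol α)

/-- The function `x ↦ ∫_0^α k(x, y) f(y) dy`. -/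
def sineIntegral (α : ℝ) (f : ℝ → ℂ) (x : ℝ) : ℂ :=
  ∫ y in Set.Icc 0 α, (sineKernel x y : ℂ) * f y

theorem L2.integrable {α : ℝ} (f : L2 α) : Integrable f (vol α) :=
  (Lp.memLp f).integrable one_le_two

theorem integrable_sineKernel_mul {α : ℝ} (f : L2 α) (x : ℝ) :
    Integrable (fun y => (sineKernel x y : ℂ) * f y) (vol α) := by
  refine (L2.integrable f).bdd_mul (c := 1) ?_ (Filter.Eventually.of_forall fun y => ?_)
  · exact (Complex.continuous_ofReal.comp
      (continuous_sineKernel.comp (Continuous.prodMk_right x))).aestronglyMeasurable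
  · rw [Complex.norm_real]
    exact abs_sineKernel_le x y

theorem norm_sineIntegral_le {α : ℝ} (f : L2 α) (x : ℝ) :
    ‖sineIntegral α f x‖ ≤ ∫ y in Set.Icc 0 α, ‖f y‖ := by
  refine norm_integral_le_of_norm_le (L2.integrable f).norm
    (Filter.Eventually.of_forall fun y => ?_)
  rw [norm_mul, Complex.norm_real]
  exact mul_le_of_le_one_left (norm_nonneg _) (abs_sineKernel_le x y)

theorem memLp_sineIntegral {α : ℝ} (f : L2 α) : MemLp (sineIntegral α f) 2 (vol α) := by
  refine MemLp.of_bound ?_ _ (Filter.Eventually.of_forall (norm_sineIntegral_le f))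
  have h : StronglyMeasurable fun p : ℝ × ℝ => (sineKernel p.1 p.2 : ℂ) * f p.2 :=
    (Complex.continuous_ofReal.comp continuous_sineKernel).stronglyMeasurable.mul
      ((Lp.stronglyMeasurable f).comp_measurable measurable_snd)
  exact h.integral_prod_right'.aestronglyMeasurable

theorem integral_norm_le {α : ℝ} (f : L2 α) :
    ∫ y in Set.Icc 0 α, ‖f y‖ ≤ ((vol α) Set.univ ^ (1 / 2 : ℝ)).toReal * ‖f‖ := by
  have h := eLpNorm_le_eLpNorm_mul_rpow_measure_univ (μ := vol α) (p := 1) (q := 2) one_le_two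
    (Lp.aestronglyMeasurable f)
  rw [integral_norm_eq_lintegral_enorm (Lp.aestronglyMeasurable f), ← eLpNorm_one_eq_lintegral_enorm,
    Lp.norm_def, ← ENNReal.toReal_mul, mul_comm]
  have e : (1 / (1 : ENNReal).toReal - 1 / (2 : ENNReal).toReal : ℝ) = 1 / 2 := by norm_num
  rw [e] at h
  refine ENNReal.toReal_mono (ENNReal.mul_ne_top (Lp.eLpNorm_ne_top f) ?_) h
  exact ENNReal.rpow_ne_top_of_nonneg (by norm_num) (measure_ne_top _ _)

/-- The integral operator `K_α` on `L²[0, α]` with the sine kernel,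
`(K_α f)(x) = ∫_0^α k(x, y) f(y) dy`. -/
def sineOperator (α : ℝ) : L2 α →L[ℂ] L2 α :=
  LinearMap.mkContinuousOfExistsBound
    { toFun := fun f => (memLp_sineIntegral f).toLp
      map_add' := fun f g => by
        rw [← MemLp.toLp_add]
        refine MemLp.toLp_congr _ _ (Filter.Eventually.of_forall fun x => ?_)
        simp only [Pi.add_apply, sineIntegral]
        rw [← integral_add (integrable_sineKernel_mul f x) (integrable_sineKernel_mul g x)]
        refine integral_congr_ae ?_
        filter_upwards [Lp.coeFn_add f g] with y hy
        rw [hy, Pi.add_apply, mul_add]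
      map_smul' := fun c f => by
        rw [RingHom.id_apply, ← MemLp.toLp_const_smul]
        refine MemLp.toLp_congr _ _ (Filter.Eventually.of_forall fun x => ?_)
        simp only [Pi.smul_apply, sineIntegral]
        rw [← integral_smul]
        refine integral_congr_ae ?_
        filter_upwards [Lp.coeFn_smul c f] with y hy
        rw [hy, Pi.smul_apply, smul_eq_mul, smul_eq_mul]
        ring }
    ⟨_, fun f => by
      refine (Lp.norm_le_of_ae_bound (C := ((vol α) Set.univ ^ (1 / 2 : ℝ)).toReal * ‖f‖)
        (by positivity) ?_).trans (mul_assoc _ _ _).symm.le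
      filter_upwards [(memLp_sineIntegral f).coeFn_toLp] with x hx
      exact hx ▸ (norm_sineIntegral_le f x).trans (integral_norm_le f)⟩

theorem sineOperator_apply (α : ℝ) (f : L2 α) :
    sineOperator α f =ᵐ[vol α] fun x => ∫ y in Set.Icc 0 α, (sineKernel x y : ℂ) * f y :=
  (memLp_sineIntegral f).coeFn_toLp

/-! ### Toeplitz matrices -/

/-- The Fourier coefficient `a_k = (2π)⁻¹ ∫_0^{2π} a(e^{iθ}) e^{-ikθ} dθ` of a function on the unit
circle. -/
def circleFourierCoeff (a : Circle → ℂ) (k : ℤ) : ℂ :=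
  (1 / (2 * Real.pi) : ℂ) *
    ∫ θ in (0 : ℝ)..(2 * Real.pi), a (Circle.exp θ) * Complex.exp (-(Complex.I * k * θ))

/-- The `n × n` Toeplitz matrix `T_n(a) = (a_{j-k})_{j,k=0}^{n-1}`. -/
def toeplitz (n : ℕ) (a : Circle → ℂ) : Matrix (Fin n) (Fin n) ℂ :=
  Matrix.of fun j k => circleFourierCoeff a ((j : ℤ) - (k : ℤ))

/-- The characteristic function of the arc `{e^{iθ} : β < θ < 2π - β}` of the unit circle. -/
def arcIndicator (β : ℝ) : Circle → ℂ :=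
  Set.indicator (Circle.exp '' Set.Ioo β (2 * Real.pi - β)) 1

end SineKernel

end

/-!
The sine kernel is the Fourier transform of an interval: `sin u / (π u) = ∫ e^{itu} dμ(t)` for the
measure `μ = dt / 2π` on `(-1, 1]`.  Hence both `K_α` and the matrix `1 - T_n(χ_{α/n})` are integrals
`∫ |φ(t)⟩⟨φ(t)| dμ(t)` of rank one operators over the same measure: for `K_α` the vector `φ(t)` is the
plane wave `x ↦ e^{itx}` in `L²[0, α]` (`inner_sineOperator`), and for the Toeplitz matrix it is the
vector `√(α/n) (e^{itjα/n})_j` in `ℂⁿ`, which samples that plane wave (`toeplitz_arcIndicator`).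

For vectors in finite dimension, Andréief's identity expands the determinant of
`1 + z ∫ |φ(t)⟩⟨φ(t)| dμ(t)` into the Fredholm series
`∑ₘ zᵐ / m! ∫ det (⟨φ(t_p), φ(t_q)⟩) dμᵐ(t)` (`det_one_add_smul_momentMatrix`), which depends only on
the inner products `⟨φ(s), φ(t)⟩`.  A Gram determinant of order `m` is at most `Cᵐ` if `‖φ(t)‖² ≤ C`
(`norm_det_gram_le`), so by dominated convergence the determinants converge as soon as the inner
products do, even if the dimension varies (`tendsto_det_one_add_smul_momentMatrix`).

This is used twice.  The inner products of the sampled waves are Riemann sums for the inner products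
of the plane waves (`tendsto_riemannSum_wave`), so that `det T_n(χ_{α/n})` converges to the Fredholm
series of the latter.  The coordinates of a plane wave in finitely many vectors of an orthonormal
basis have inner products that tend to the true ones by Parseval's formula, so that the determinants
of the finite sections of `1 - K_α` converge to the same series; as the principal minors of the
positive operator `K_α` are nonnegative, this identifies the sum of all principal minors
(`IsRankOneIntegral.hasOperatorDet`).  Bessel's inequality shows that `K_α` is trace class.
-/

namespace SineKernel

open Filter Topology
open scoped ComplexConjugate ComplexOrder

/-! ### Finite determinants and their principal minors -/

/-- The expansion of `det (1 + z A)` into principal minors: Mathlib has it for the coefficients of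
the polynomial `det (1 + X A)`. -/
theorem det_one_add_smul_eq_sum_minors {n : Type*} [Fintype n] [DecidableEq n]
    (A : Matrix n n ℂ) (z : ℂ) :
    (1 + z • A).det = ∑ S : Finset n,
      z ^ S.card * (A.submatrix (Subtype.val : S → n) (Subtype.val : S → n)).det := by
  have h0 : (1 + z • A).det =
      Polynomial.eval z (1 + (Polynomial.X : Polynomial ℂ) • A.map Polynomial.C).det := by
    rw [← Polynomial.coe_evalRingHom, RingHom.map_det]
    congr 1
    ext i j
    simp [Matrix.one_apply, apply_ite (Polynomial.eval z)]
    ring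
  have hcard : ∀ S ∈ (Finset.univ : Finset (Finset n)),
      S.card ∈ Finset.range (Fintype.card n + 1) := fun S _ =>
    Finset.mem_range.2 (Nat.lt_succ_of_le (Finset.card_le_univ S))
  have hdeg : (1 + (Polynomial.X : Polynomial ℂ) • A.map Polynomial.C).det.natDegree
      < Fintype.card n + 1 := by
    refine Nat.lt_succ_of_le (Polynomial.natDegree_le_iff_coeff_eq_zero.2 fun k hk => ?_)
    rw [Matrix.coeff_det_one_add_X_smul_eq_sum_minors, Finset.powersetCard_eq_empty.2,
      Finset.sum_empty]
    exact hk
  rw [h0, Polynomial.eval_eq_sum_range' hdeg, ← Finset.sum_fiberwise_of_maps_to hcard]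
  refine Finset.sum_congr rfl fun k _ => ?_
  rw [Matrix.coeff_det_one_add_X_smul_eq_sum_minors, Finset.sum_mul, Finset.powersetCard_eq_filter,
    Finset.powerset_univ]
  refine Finset.sum_congr rfl fun S hS => ?_
  rw [(Finset.mem_filter.1 hS).2, mul_comm]

/-- The determinants `det (A (r p) (r q))` over all tuples `r` of length `m`: tuples with a
repetition contribute nothing, and every set of size `m` is enumerated by `m!` tuples. -/
theorem sum_det_submatrix_tuples {n : Type*} [Fintype n] [DecidableEq n]
    (A : Matrix n n ℂ) (m : ℕ) :
    ∑ r : Fin m → n, (A.submatrix r r).det = (m.factorial : ℂ) * ∑ S ∈ Finset.univ.powersetCard m,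
      (A.submatrix (Subtype.val : S → n) (Subtype.val : S → n)).det := by
  classical
  have h1 : ∑ r : Fin m → n, (A.submatrix r r).det =
      ∑ r : Fin m → n with Function.Injective r, (A.submatrix r r).det := by
    symm
    refine Finset.sum_filter_of_ne fun r _ hr => ?_
    by_contra hinj
    obtain ⟨i, j, hij, hne⟩ : ∃ i j, r i = r j ∧ i ≠ j := by
      simpa [Function.Injective] using hinj
    refine hr (Matrix.det_zero_of_row_eq hne ?_)
    ext k
    simp [hij]
  have h2 : ∀ r ∈ (Finset.univ.filter fun r : Fin m → n => Function.Injective r),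
      Finset.univ.image r ∈ Finset.univ.powersetCard m := by
    intro r hr
    simp [Finset.mem_powersetCard, Finset.card_image_of_injective _ (Finset.mem_filter.1 hr).2]
  rw [h1, ← Finset.sum_fiberwise_of_maps_to h2, Finset.mul_sum]
  refine Finset.sum_congr rfl fun S hS => ?_
  have hSm : S.card = m := (Finset.mem_powersetCard.1 hS).2
  have hmem : ∀ r : Fin m → n, Finset.univ.image r = S → ∀ p, r p ∈ S := fun r hr p =>
    hr ▸ Finset.mem_image_of_mem r (Finset.mem_univ p)
  have hbij : ∀ r : Fin m → n, Function.Injective r → (h : Finset.univ.image r = S) →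
      Function.Bijective fun p => (⟨r p, hmem r h p⟩ : S) := by
    intro r hr h
    refine (Fintype.bijective_iff_injective_and_card _).2 ⟨fun p q hpq => ?_, by simp [hSm]⟩
    exact hr (congrArg Subtype.val hpq)
  rw [Finset.sum_congr rfl (g := fun _ =>
    (A.submatrix (Subtype.val : S → n) (Subtype.val : S → n)).det)]
  · rw [Finset.sum_const, nsmul_eq_mul]
    congr 2
    rw [← Finset.card_bij' (s := (Finset.univ : Finset (Fin m ≃ S)))
      (i := fun e _ => fun p => ((e p : S) : n))
      (j := fun r hr => Equiv.ofBijective _ (hbij r (Finset.mem_filter.1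
        (Finset.mem_filter.1 hr).1).2 (Finset.mem_filter.1 hr).2))]
    · rw [Finset.card_univ, Fintype.card_equiv (Fintype.equivOfCardEq (by simp [hSm])),
        Fintype.card_fin]
    · intro e _
      refine Finset.mem_filter.2 ⟨Finset.mem_filter.2 ⟨Finset.mem_univ _,
        Subtype.val_injective.comp e.injective⟩, ?_⟩
      ext x
      simp only [Finset.mem_image, Finset.mem_univ, true_and]
      exact ⟨fun ⟨p, hp⟩ => hp ▸ (e p).2, fun hx => ⟨e.symm ⟨x, hx⟩, by simp⟩⟩
    · exact fun r _ => Finset.mem_univ _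
    · intro e _
      ext p
      rfl
    · intro r _
      rfl
  · intro r hr
    have hr1 := (Finset.mem_filter.1 (Finset.mem_filter.1 hr).1).2
    have hr2 := (Finset.mem_filter.1 hr).2
    exact (Matrix.det_submatrix_equiv_self (Equiv.ofBijective _ (hbij r hr1 hr2))
      (A.submatrix (Subtype.val : S → n) (Subtype.val : S → n)))

/-- A Gram determinant of vectors of squared length at most `C` is at most `C ^ m`, by the
inequality of the arithmetic and geometric means for the eigenvalues of the Gram matrix. -/
theorem norm_det_gram_le {E : Type*} [NormedAddCommGroup E] [InnerProductSpace ℂ E] {m : ℕ}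
    (v : Fin m → E) {C : ℝ} (hv : ∀ p, ‖v p‖ ^ 2 ≤ C) : ‖(Matrix.gram ℂ v).det‖ ≤ C ^ m := by
  have hP : (Matrix.gram ℂ v).PosSemidef := Matrix.posSemidef_gram ℂ v
  have hl := hP.eigenvalues_nonneg
  have htr : ∑ i, hP.isHermitian.eigenvalues i ≤ m * C := by
    have h := hP.isHermitian.trace_eq_sum_eigenvalues
    have h' : (((∑ p, ‖v p‖ ^ 2 : ℝ)) : ℂ) = ((∑ i, hP.isHermitian.eigenvalues i : ℝ) : ℂ) := by
      rw [Complex.ofReal_sum, Complex.ofReal_sum]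
      simpa [Matrix.trace, inner_self_eq_norm_sq_to_K] using h
    rw [← Complex.ofReal_injective h']
    simpa using Finset.sum_le_sum fun p (_ : p ∈ Finset.univ) => hv p
  rw [hP.isHermitian.det_eq_prod_eigenvalues, norm_prod]
  have hn : ∀ i, ‖((hP.isHermitian.eigenvalues i : ℝ) : ℂ)‖ = hP.isHermitian.eigenvalues i :=
    fun i => by rw [Complex.norm_real, Real.norm_of_nonneg (hl i)]
  simp only [Complex.coe_algebraMap, hn]
  rcases Nat.eq_zero_or_pos m with rfl | hm
  · simp
  have hm' : (0 : ℝ) < m := by exact_mod_cast hm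
  have h := Real.geom_mean_le_arith_mean Finset.univ (fun _ => 1)
    hP.isHermitian.eigenvalues (by simp) (by simpa using hm) (fun i _ => hl i)
  simp only [Real.rpow_one, Finset.sum_const, Finset.card_univ, Fintype.card_fin, nsmul_eq_mul,
    mul_one, one_mul] at h
  have h0 : 0 ≤ ∏ i, hP.isHermitian.eigenvalues i := Finset.prod_nonneg fun i _ => hl i
  calc ∏ i, hP.isHermitian.eigenvalues i
      = ((∏ i, hP.isHermitian.eigenvalues i) ^ ((m : ℝ)⁻¹)) ^ m :=
        (Real.rpow_inv_natCast_pow h0 hm.ne').symm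
    _ ≤ C ^ m := by
        refine pow_le_pow_left₀ (by positivity) (h.trans ?_) m
        rw [div_le_iff₀ hm', mul_comm C]
        exact htr

/-! ### The Fredholm series of an integral of rank one operators -/

section Fredholm

variable {T : Type*} [MeasurableSpace T] {μ : Measure T} [IsFiniteMeasure μ]

/-- The matrix `∫ v(t) v(t)* dμ(t)` of an integral of rank one operators on `ℂⁿ`. -/
noncomputable def momentMatrix {n : Type*} (μ : Measure T) (v : T → EuclideanSpace ℂ n) :
    Matrix n n ℂ :=
  Matrix.of fun i j => ∫ t, v t i * conj (v t j) ∂μ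

/-- The term of order `m` of the Fredholm series `∑ₘ zᵐ / m! ∫ det (g(t_p, t_q)) dμᵐ(t)` of a
kernel `g`. -/
noncomputable def fredholmTerm (μ : Measure T) (z : ℂ) (g : T → T → ℂ) (m : ℕ) : ℂ :=
  z ^ m / (m.factorial : ℂ) *
    ∫ t : Fin m → T, (Matrix.of fun p q => g (t p) (t q)).det ∂(Measure.pi fun _ => μ)

theorem integrable_coord_mul_conj {n : Type*} [Fintype n] {v : T → EuclideanSpace ℂ n}
    (hv : Measurable v) {C : ℝ} (hC : ∀ t, ‖v t‖ ^ 2 ≤ C) (i j : n) :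
    Integrable (fun t => v t i * conj (v t j)) μ := by
  have hm : ∀ i, Measurable fun t => v t i := fun i =>
    ((EuclideanSpace.proj (𝕜 := ℂ) i).continuous.measurable.comp hv)
  refine Integrable.of_bound ((hm i).mul
    (Complex.continuous_conj.measurable.comp (hm j))).aestronglyMeasurable C
    (Eventually.of_forall fun t => ?_)
  rw [norm_mul, RCLike.norm_conj]
  refine le_trans ?_ ((sq ‖v t‖).symm.le.trans (hC t))
  exact mul_le_mul (PiLp.norm_apply_le _ _) (PiLp.norm_apply_le _ _) (norm_nonneg _) (norm_nonneg _)

/-- Summing over the tuple `r` before the permutation turns the products over `r` into products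
of inner products; in this way multilinearity of the determinant turns a sum over all tuples
of coordinates into a Gram determinant. -/
theorem sum_tuples_eq_det_gram {n : Type*} [Fintype n] {m : ℕ} (w : Fin m → EuclideanSpace ℂ n) :
    ∑ r : Fin m → n, ∑ σ : Equiv.Perm (Fin m), (Equiv.Perm.sign σ : ℂ) *
      ∏ p, (w p (r (σ p)) * conj (w p (r p))) = (Matrix.gram ℂ w).det := by
  rw [Finset.sum_comm, ← Matrix.det_transpose, Matrix.det_apply', ← Equiv.sum_comp (Equiv.inv _)]
  refine Finset.sum_congr rfl fun σ _ => ?_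
  rw [← Finset.mul_sum]
  simp only [Equiv.inv_apply, Equiv.Perm.sign_inv]
  congr 1
  have h : ∀ r : Fin m → n, ∏ p, (w p (r (σ⁻¹ p)) * conj (w p (r p))) =
      ∏ p, (w (σ p) (r p) * conj (w p (r p))) := by
    intro r
    rw [Finset.prod_mul_distrib, Finset.prod_mul_distrib]
    congr 1
    rw [← Equiv.prod_comp σ]
    simp
  simp only [h]
  rw [← Fintype.piFinset_univ,
    ← Finset.prod_univ_sum (fun _ => Finset.univ) fun p i => w (σ p) i * conj (w p i)]
  simp [Matrix.gram, PiLp.inner_apply]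

/-- Andréief's identity, summed over all tuples of indices: by Fubini's theorem each product of
entries of the moment matrix is an integral over `m` variables. -/
theorem sum_det_submatrix_momentMatrix {n : Type*} [Fintype n]
    {v : T → EuclideanSpace ℂ n} (hv : Measurable v) {C : ℝ} (hC : ∀ t, ‖v t‖ ^ 2 ≤ C) (m : ℕ) :
    ∑ r : Fin m → n, ((momentMatrix μ v).submatrix r r).det =
      ∫ t : Fin m → T, (Matrix.of fun p q => inner ℂ (v (t p)) (v (t q))).det
        ∂(Measure.pi fun _ => μ) := by
  have hint : ∀ (r : Fin m → n) (σ : Equiv.Perm (Fin m)),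
      Integrable (fun t : Fin m → T => (Equiv.Perm.sign σ : ℂ) *
        ∏ p, (v (t p) (r (σ p)) * conj (v (t p) (r p)))) (Measure.pi fun _ => μ) := fun r σ =>
    (Integrable.fintype_prod (f := fun p t => v t (r (σ p)) * conj (v t (r p)))
      fun p => integrable_coord_mul_conj hv hC _ _).const_mul _
  calc ∑ r : Fin m → n, ((momentMatrix μ v).submatrix r r).det
      = ∑ r : Fin m → n, ∑ σ : Equiv.Perm (Fin m), ∫ t : Fin m → T, (Equiv.Perm.sign σ : ℂ) *
          ∏ p, (v (t p) (r (σ p)) * conj (v (t p) (r p))) ∂(Measure.pi fun _ => μ) := by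
        refine Finset.sum_congr rfl fun r _ => ?_
        rw [Matrix.det_apply']
        refine Finset.sum_congr rfl fun σ _ => ?_
        rw [integral_const_mul, integral_fintype_prod_eq_prod
          (f := fun p t => v t (r (σ p)) * conj (v t (r p)))]
        rfl
    _ = ∫ t : Fin m → T, ∑ r : Fin m → n, ∑ σ : Equiv.Perm (Fin m), (Equiv.Perm.sign σ : ℂ) *
          ∏ p, (v (t p) (r (σ p)) * conj (v (t p) (r p))) ∂(Measure.pi fun _ => μ) := by
        rw [integral_finsetSum _ fun r _ => integrable_finsetSum _ fun σ _ => hint r σ]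
        refine Finset.sum_congr rfl fun r _ => ?_
        rw [integral_finsetSum _ fun σ _ => hint r σ]
    _ = _ := by
        refine integral_congr_ae (Eventually.of_forall fun t => ?_)
        exact sum_tuples_eq_det_gram fun p => v (t p)

theorem norm_fredholmTerm_le {E : Type*} [NormedAddCommGroup E] [InnerProductSpace ℂ E]
    {v : T → E} {C : ℝ} (hC : ∀ t, ‖v t‖ ^ 2 ≤ C) (z : ℂ) (m : ℕ) :
    ‖fredholmTerm μ z (fun s t => inner ℂ (v s) (v t)) m‖ ≤
      (‖z‖ * (C * μ.real Set.univ)) ^ m / (m.factorial : ℝ) := by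
  rw [fredholmTerm, norm_mul, norm_div, norm_pow, Complex.norm_natCast]
  have h := norm_integral_le_of_norm_le_const (μ := Measure.pi fun _ : Fin m => μ)
    (f := fun t : Fin m → T => (Matrix.of fun p q => inner ℂ (v (t p)) (v (t q))).det)
    (C := C ^ m) (Eventually.of_forall fun t => norm_det_gram_le (fun p => v (t p)) fun p => hC _)
  have h2 : (Measure.pi fun _ : Fin m => μ).real Set.univ = μ.real Set.univ ^ m := by
    simp [measureReal_def, Measure.pi_univ, ENNReal.toReal_pow]
  rw [h2] at h
  calc _ ≤ ‖z‖ ^ m / (m.factorial : ℝ) * (C ^ m * μ.real Set.univ ^ m) := by gcongr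
    _ = _ := by rw [mul_pow, mul_pow]; ring

/-- The Fredholm expansion of the determinant of `1 + z ∫ v(t) v(t)* dμ(t)`. -/
theorem det_one_add_smul_momentMatrix {n : Type*} [Fintype n] [DecidableEq n]
    {v : T → EuclideanSpace ℂ n} (hv : Measurable v) {C : ℝ} (hC : ∀ t, ‖v t‖ ^ 2 ≤ C) (z : ℂ) :
    (1 + z • momentMatrix μ v).det =
      ∑' m, fredholmTerm μ z (fun s t => inner ℂ (v s) (v t)) m := by
  have hterm : ∀ m, fredholmTerm μ z (fun s t => inner ℂ (v s) (v t)) m =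
      ∑ S ∈ Finset.univ.powersetCard m, z ^ S.card *
        ((momentMatrix μ v).submatrix (Subtype.val : S → n) (Subtype.val : S → n)).det := by
    intro m
    rw [fredholmTerm, ← sum_det_submatrix_momentMatrix hv hC, sum_det_submatrix_tuples,
      ← mul_assoc, div_mul_cancel₀ _ (by exact_mod_cast m.factorial_ne_zero), Finset.mul_sum]
    exact Finset.sum_congr rfl fun S hS => by rw [(Finset.mem_powersetCard.1 hS).2]
  -- Beyond the dimension the terms vanish, as there are no minors of that size.
  rw [tsum_eq_sum (s := Finset.range (Fintype.card n + 1)), det_one_add_smul_eq_sum_minors,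
    ← Finset.powerset_univ, Finset.sum_powerset]
  · exact Finset.sum_congr rfl fun m _ => (hterm m).symm
  · intro m hm
    rw [hterm, Finset.powersetCard_eq_empty.2, Finset.sum_empty]
    rw [Finset.mem_range, not_lt] at hm
    exact hm

theorem norm_det_one_add_smul_momentMatrix_le {n : Type*} [Fintype n] [DecidableEq n]
    {v : T → EuclideanSpace ℂ n} (hv : Measurable v) {C : ℝ} (hC : ∀ t, ‖v t‖ ^ 2 ≤ C) (z : ℂ) :
    ‖(1 + z • momentMatrix μ v).det‖ ≤ Real.exp (‖z‖ * (C * μ.real Set.univ)) := by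
  rw [det_one_add_smul_momentMatrix hv hC, Real.exp_eq_exp_ℝ]
  exact tsum_of_norm_bounded (NormedSpace.expSeries_div_hasSum_exp _)
    (norm_fredholmTerm_le hC z)

/-- If the kernels `⟨v(s), v(t)⟩` converge pointwise and boundedly, the determinants of
`1 + z ∫ v(t) v(t)* dμ(t)` converge to the Fredholm series of the limit kernel, whatever the
dimensions of the vectors `v(t)` are. -/
theorem tendsto_det_one_add_smul_momentMatrix {N : Type*} {l : Filter N} [l.IsCountablyGenerated]
    {n : N → Type*} [∀ k, Fintype (n k)] [∀ k, DecidableEq (n k)]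
    {v : ∀ k, T → EuclideanSpace ℂ (n k)} (hv : ∀ k, Measurable (v k)) {C : ℝ}
    (hC : ∀ k t, ‖v k t‖ ^ 2 ≤ C) {g : T → T → ℂ}
    (hg : ∀ s t, Tendsto (fun k => inner ℂ (v k s) (v k t)) l (𝓝 (g s t))) (z : ℂ) :
    Tendsto (fun k => (1 + z • momentMatrix μ (v k)).det) l (𝓝 (∑' m, fredholmTerm μ z g m)) := by
  simp only [fun k => det_one_add_smul_momentMatrix (μ := μ) (hv k) (hC k) z]
  refine tendsto_tsum_of_dominated_convergence
    (NormedSpace.expSeries_div_summable (‖z‖ * (C * μ.real Set.univ))) (fun m => ?_)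
    (Eventually.of_forall fun k m => norm_fredholmTerm_le (hC k) z m)
  refine Tendsto.const_mul _ (tendsto_integral_filter_of_dominated_convergence (fun _ => C ^ m)
    (Eventually.of_forall fun k => ?_)
    (Eventually.of_forall fun k => Eventually.of_forall fun t =>
      norm_det_gram_le (fun p => v k (t p)) fun p => hC k _)
    (integrable_const _) (Eventually.of_forall fun t => ?_))
  · refine Measurable.aestronglyMeasurable ?_
    simp only [Matrix.det_apply']
    refine Finset.measurable_sum _ fun σ _ => Measurable.const_mul
      (Finset.measurable_prod _ fun p _ => ?_) _
    exact Measurable.inner ((hv k).comp (measurable_pi_apply _))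
      ((hv k).comp (measurable_pi_apply _))
  · simp only [Matrix.det_apply']
    exact tendsto_finsetSum _ fun σ _ => Tendsto.const_mul _
      (tendsto_finsetProd _ fun p _ => hg _ _)

end Fredholm

/-! ### The operator determinant of an integral of rank one operators -/

/-- The principal minors with index set inside `F` sum, with the weights `z ^ |S|`, to the
determinant of the finite section of `1 + z A` over `F`. -/
theorem sum_powerset_det_submatrix {ι : Type*} [DecidableEq ι] (A : Matrix ι ι ℂ) (z : ℂ)
    (F : Finset ι) :
    ∑ S ∈ F.powerset, z ^ S.card * (A.submatrix (Subtype.val : S → ι) (Subtype.val : S → ι)).det =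
      (1 + z • A.submatrix (Subtype.val : F → ι) (Subtype.val : F → ι)).det := by
  rw [det_one_add_smul_eq_sum_minors]
  symm
  refine Finset.sum_bij (fun S _ => S.map (Function.Embedding.subtype (· ∈ F)))
    (fun S _ => ?_) (fun S _ S' _ h => Finset.map_injective _ h) (fun S hS => ?_) (fun S _ => ?_)
  · rw [Finset.mem_powerset]
    intro i hi
    obtain ⟨j, -, rfl⟩ := Finset.mem_map.1 hi
    exact j.2
  · exact ⟨S.subtype (· ∈ F), Finset.mem_univ _,
      Finset.subtype_map_of_mem fun i hi => Finset.mem_powerset.1 hS hi⟩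
  · rw [Finset.card_map]
    congr 1
    let eqv : S ≃ S.map (Function.Embedding.subtype (· ∈ F)) :=
      Equiv.ofBijective
        (fun i => ⟨i.1.1, Finset.mem_map_of_mem (Function.Embedding.subtype (· ∈ F)) i.2⟩)
        ⟨fun i j h => Subtype.ext (Subtype.ext (Subtype.mk.inj h)), fun ⟨i, hi⟩ => by
          obtain ⟨j, hj, rfl⟩ := Finset.mem_map.1 hi
          exact ⟨⟨j, hj⟩, rfl⟩⟩
    exact Matrix.det_submatrix_equiv_self eqv (A.submatrix (Subtype.val :
      S.map (Function.Embedding.subtype (· ∈ F)) → ι) Subtype.val)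

/-- Balls of radius `1 / 2` around the vectors of an orthonormal family are disjoint. -/
theorem countable_of_orthonormal {H : Type*} [NormedAddCommGroup H] [InnerProductSpace ℂ H]
    [TopologicalSpace.SeparableSpace H] {ι : Type*} {e : ι → H} (he : Orthonormal ℂ e) :
    Countable ι := by
  refine Pairwise.countable_of_isOpen_disjoint (s := fun i => Metric.ball (e i) (1 / 2))
    (fun i j hij => Metric.ball_disjoint_ball ?_) (fun i => Metric.isOpen_ball)
    (fun i => ⟨e i, Metric.mem_ball_self (by norm_num)⟩)
  have h : ‖e i - e j‖ ^ 2 = 2 := by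
    rw [@norm_sub_sq ℂ, he.1 i, he.1 j, he.2 hij]
    norm_num
  rw [dist_eq_norm]
  nlinarith [norm_nonneg (e i - e j)]

section RankOne

universe u

variable {H : Type u} [NormedAddCommGroup H] [InnerProductSpace ℂ H]
variable {T : Type*} [MeasurableSpace T]

/-- The operator `A` is the weak integral `∫ |φ(t)⟩⟨φ(t)| dμ(t)` of rank one operators, with `φ`
weakly measurable and `‖φ(t)‖² ≤ C`. -/
structure IsRankOneIntegral (A : H →L[ℂ] H) (μ : Measure T) (φ : T → H) (C : ℝ) : Prop where
  measurable_inner : ∀ f : H, Measurable fun t => (inner ℂ f (φ t) : ℂ)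
  norm_sq_le : ∀ t, ‖φ t‖ ^ 2 ≤ C
  inner_apply : ∀ f g : H, inner ℂ f (A g) = ∫ t, inner ℂ f (φ t) * inner ℂ (φ t) g ∂μ

namespace IsRankOneIntegral

variable {A : H →L[ℂ] H} {μ : Measure T} {φ : T → H} {C : ℝ}

theorem inner_self_eq (h : IsRankOneIntegral A μ φ C) (f : H) :
    inner ℂ f (A f) = ((∫ t, ‖(inner ℂ f (φ t) : ℂ)‖ ^ 2 ∂μ : ℝ) : ℂ) := by
  rw [h.inner_apply, ← integral_complex_ofReal]
  refine integral_congr_ae (Eventually.of_forall fun t => ?_)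
  simp only
  rw [← inner_conj_symm (φ t) f, Complex.mul_conj, Complex.normSq_eq_norm_sq]

theorem nonneg [CompleteSpace H] (h : IsRankOneIntegral A μ φ C) : 0 ≤ A := by
  rw [ContinuousLinearMap.nonneg_iff_isPositive, ContinuousLinearMap.isPositive_iff_complex]
  intro f
  rw [← inner_conj_symm (A f) f, h.inner_self_eq]
  simp only [Complex.conj_ofReal, RCLike.re_eq_complex_re, Complex.ofReal_re, true_and]
  exact integral_nonneg fun t => by positivity

/-- The coordinates of `φ` in finitely many vectors of an orthonormal basis. -/
noncomputable def coords {ι : Type*} (e : ι → H) (φ : T → H) (F : Finset ι) (t : T) :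
    EuclideanSpace ℂ F :=
  WithLp.toLp 2 fun i : F => inner ℂ (e i) (φ t)

theorem measurable_coords (h : IsRankOneIntegral A μ φ C) {ι : Type*} (e : ι → H)
    (F : Finset ι) : Measurable (coords e φ F) :=
  (PiLp.continuous_toLp 2 _).measurable.comp
    (measurable_pi_lambda _ fun i => h.measurable_inner (e i))

theorem sum_norm_inner_sq_le (h : IsRankOneIntegral A μ φ C) {ι : Type*} {e : ι → H}
    (he : Orthonormal ℂ e) (F : Finset ι) (t : T) :
    ∑ i ∈ F, ‖(inner ℂ (e i) (φ t) : ℂ)‖ ^ 2 ≤ C :=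
  (he.sum_inner_products_le (φ t)).trans (h.norm_sq_le t)

theorem norm_coords_sq_le (h : IsRankOneIntegral A μ φ C) {ι : Type*} {e : ι → H}
    (he : Orthonormal ℂ e) (F : Finset ι) (t : T) : ‖coords e φ F t‖ ^ 2 ≤ C := by
  rw [EuclideanSpace.norm_sq_eq]
  refine le_trans (le_of_eq ?_) (h.sum_norm_inner_sq_le he F t)
  exact Finset.sum_coe_sort F fun i => ‖(inner ℂ (e i) (φ t) : ℂ)‖ ^ 2

theorem momentMatrix_coords (h : IsRankOneIntegral A μ φ C) {ι : Type*} (e : ι → H)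
    (F : Finset ι) : momentMatrix μ (coords e φ F) =
      (Matrix.of fun i j => inner ℂ (e i) (A (e j))).submatrix
        (Subtype.val : F → ι) (Subtype.val : F → ι) := by
  ext i j
  simp only [momentMatrix, coords, Matrix.of_apply, Matrix.submatrix_apply, h.inner_apply,
    inner_conj_symm]

theorem tendsto_inner_coords {X : Type*} {φ : X → H} {ι : Type*} [CompleteSpace H]
    (e : HilbertBasis ι ℂ H) (s t : X) :
    Tendsto (fun F => inner ℂ (coords e φ F s) (coords e φ F t)) atTop
      (𝓝 (inner ℂ (φ s) (φ t))) := by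
  refine (e.hasSum_inner_mul_inner (φ s) (φ t)).congr fun F => ?_
  rw [PiLp.inner_apply, ← Finset.sum_coe_sort F]
  refine Finset.sum_congr rfl fun i _ => ?_
  simp [coords, mul_comm]

variable [CompleteSpace H]

/-- The matrix of `A` is the Gram matrix of the vectors `A^{1/2} eᵢ`. -/
theorem det_minor_nonneg (h : IsRankOneIntegral A μ φ C) {ι : Type*} [DecidableEq ι] (e : ι → H)
    (S : Finset ι) :
    0 ≤ ((Matrix.of fun i j => inner ℂ (e i) (A (e j))).submatrix
      (Subtype.val : S → ι) (Subtype.val : S → ι)).det := by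
  have hB := (ContinuousLinearMap.nonneg_iff_isPositive _).1 (CFC.sqrt_nonneg A)
  have hsq : CFC.sqrt A * CFC.sqrt A = A := CFC.sqrt_mul_sqrt_self A h.nonneg
  have hM : (Matrix.of fun i j => inner ℂ (e i) (A (e j))).submatrix
      (Subtype.val : S → ι) (Subtype.val : S → ι) =
        Matrix.gram ℂ fun i : S => CFC.sqrt A (e i) := by
    ext i j
    simp only [Matrix.submatrix_apply, Matrix.of_apply, Matrix.gram_apply]
    conv_lhs => rw [← hsq]
    exact (hB.isSymmetric (e i) (CFC.sqrt A (e j))).symm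
  rw [hM]
  exact (Matrix.posSemidef_gram ℂ _).det_nonneg

variable [IsFiniteMeasure μ]

/-- Here `|-A| = A`, and Bessel's inequality bounds the partial sums of its trace by `C μ(T)`. -/
theorem isTraceClass_neg (h : IsRankOneIntegral A μ φ C) : IsTraceClass (-A) := by
  intro ι e
  rw [CFC.abs_neg, CFC.abs_of_nonneg A h.nonneg]
  have hre : ∀ i, RCLike.re (inner ℂ (e i) (A (e i))) =
      ∫ t, ‖(inner ℂ (e i) (φ t) : ℂ)‖ ^ 2 ∂μ := fun i => by
    rw [h.inner_self_eq, RCLike.re_eq_complex_re, Complex.ofReal_re]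
  simp only [hre]
  refine summable_of_sum_le (c := μ.real Set.univ * C)
    (fun i => integral_nonneg fun t => by positivity) fun F => ?_
  have hint : ∀ i ∈ F, Integrable (fun t => ‖(inner ℂ (e i) (φ t) : ℂ)‖ ^ 2) μ := fun i _ => by
    refine Integrable.of_bound ((h.measurable_inner (e i)).norm.pow_const 2).aestronglyMeasurable C
      (Eventually.of_forall fun t => ?_)
    rw [Real.norm_of_nonneg (by positivity)]
    simpa using h.sum_norm_inner_sq_le e.orthonormal {i} t
  rw [← integral_finsetSum _ hint]
  calc _ ≤ ∫ _, C ∂μ := integral_mono (integrable_finsetSum _ hint) (integrable_const C)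
        fun t => h.sum_norm_inner_sq_le e.orthonormal F t
    _ = _ := by simp

/-- The operator determinant of `1 - ∫ |φ(t)⟩⟨φ(t)| dμ(t)` is the Fredholm series of the kernel
`⟨φ(s), φ(t)⟩`.  The minors of `A` are nonnegative, so that the sum over all of them converges
absolutely and may be computed along the subsets of a growing finite set `F` of basis vectors;
these sum to the determinant of the compression of `1 - A` to the span of `F`. -/
theorem hasOperatorDet [TopologicalSpace.SeparableSpace H] (h : IsRankOneIntegral A μ φ C) :
    HasOperatorDet (1 - A) (∑' m, fredholmTerm μ (-1) (fun s t => inner ℂ (φ s) (φ t)) m) := by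
  classical
  have hA : 1 - A - 1 = -A := by abel
  refine ⟨hA ▸ h.isTraceClass_neg, fun ι e => ?_⟩
  rw [hA]
  have : Countable ι := countable_of_orthonormal e.orthonormal
  set M : Matrix ι ι ℂ := Matrix.of fun i j => inner ℂ (e i) (A (e j)) with hMdef
  have hminor : ∀ S : Finset ι, principalMinor e (-A) S = (-1) ^ S.card *
      (M.submatrix (Subtype.val : S → ι) (Subtype.val : S → ι)).det := by
    intro S
    have hneg : (Matrix.of fun i j : S => (inner ℂ (e i) ((-A) (e j)) : ℂ)) =
        -(M.submatrix (Subtype.val : S → ι) (Subtype.val : S → ι)) := by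
      ext i j
      simp [hMdef]
    rw [← Fintype.card_coe S, ← Matrix.det_neg, ← hneg, principalMinor]
  have hsum : ∀ (z : ℂ) (F : Finset ι), ∑ S ∈ F.powerset, z ^ S.card *
      (M.submatrix (Subtype.val : S → ι) (Subtype.val : S → ι)).det =
        (1 + z • momentMatrix μ (coords e φ F)).det := fun z F => by
    rw [sum_powerset_det_submatrix, h.momentMatrix_coords]
  have hsummable : Summable (principalMinor e (-A)) := by
    refine Summable.of_norm (summable_of_sum_le
      (c := Real.exp (‖(1 : ℂ)‖ * (C * μ.real Set.univ))) (fun _ => norm_nonneg _) fun 𝒮 => ?_)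
    -- A finite set of index sets lies in the powerset of their union, over which the moduli of the
    -- minors sum to the determinant of `1 + A` in place of `1 - A`.
    have hsub : 𝒮 ⊆ (𝒮.sup id).powerset := fun S hS =>
      Finset.mem_powerset.2 (Finset.le_sup (f := id) hS)
    refine (Finset.sum_le_sum_of_subset_of_nonneg hsub fun _ _ _ => norm_nonneg _).trans ?_
    refine le_trans ?_ (norm_det_one_add_smul_momentMatrix_le (μ := μ)
      (h.measurable_coords e (𝒮.sup id)) (h.norm_coords_sq_le e.orthonormal _) 1)
    rw [← hsum]
    have hn : ∀ S : Finset ι, ((‖principalMinor e (-A) S‖ : ℝ) : ℂ) = 1 ^ S.card *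
        (M.submatrix (Subtype.val : S → ι) (Subtype.val : S → ι)).det := fun S => by
      rw [hminor, norm_mul, norm_pow, norm_neg, norm_one, one_pow, one_pow, one_mul, one_mul]
      exact RCLike.norm_of_nonneg' (h.det_minor_nonneg e S)
    simp only [← hn]
    rw [← Complex.ofReal_sum, Complex.norm_real]
    exact le_abs_self _
  have hlim := tendsto_det_one_add_smul_momentMatrix (μ := μ) (h.measurable_coords e)
    (h.norm_coords_sq_le e.orthonormal) (fun s t => tendsto_inner_coords (φ := φ) e s t) (-1)
  have hlim' := hsummable.hasSum.comp tendsto_finset_powerset_atTop_atTop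
  have heq : (fun F : Finset ι => (1 + (-1 : ℂ) • momentMatrix μ (coords e φ F)).det) =
      (fun 𝒮 : Finset (Finset ι) => ∑ S ∈ 𝒮, principalMinor e (-A) S) ∘ Finset.powerset := by
    ext F
    rw [← hsum, Function.comp_apply]
    exact Finset.sum_congr rfl fun S _ => (hminor S).symm
  rw [heq] at hlim
  rw [tendsto_nhds_unique hlim hlim']
  exact hsummable.hasSum

end IsRankOneIntegral

end RankOne

/-! ### Plane waves and the sine kernel -/

/-- The plane wave `e^{itx}`. -/
noncomputable def wave (t x : ℝ) : ℂ := Complex.exp ((t * x : ℝ) * Complex.I)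

/-- The measure `dt / 2π` on `(-1, 1]`, whose Fourier transform is `sin u / (π u)`. -/
noncomputable def bandMeasure : Measure ℝ :=
  ENNReal.ofReal (1 / (2 * Real.pi)) • volume.restrict (Set.Ioc (-1) 1)

instance : IsFiniteMeasure bandMeasure := by
  exact Measure.smul_finite _ ENNReal.ofReal_ne_top

theorem continuous_wave : Continuous fun p : ℝ × ℝ => wave p.1 p.2 := by
  unfold wave
  fun_prop

theorem continuous_wave_left (x : ℝ) : Continuous fun t => wave t x :=
  continuous_wave.comp (Continuous.prodMk_left x)

theorem continuous_wave_right (t : ℝ) : Continuous fun x => wave t x :=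
  continuous_wave.comp (Continuous.prodMk_right t)

theorem norm_wave (t x : ℝ) : ‖wave t x‖ = 1 := Complex.norm_exp_ofReal_mul_I _

theorem wave_comm (t x : ℝ) : wave t x = wave x t := by rw [wave, wave, mul_comm t]

theorem conj_wave (t x : ℝ) : conj (wave t x) = wave t (-x) := by
  rw [wave, wave, ← Complex.exp_conj, map_mul, Complex.conj_ofReal, Complex.conj_I]
  push_cast
  ring_nf

theorem wave_mul_conj_wave (t x y : ℝ) : wave t x * conj (wave t y) = wave t (x - y) := by
  rw [conj_wave, wave, wave, wave, ← Complex.exp_add]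
  push_cast
  ring_nf

theorem wave_mul_conj_wave_left (s t x : ℝ) : wave t x * conj (wave s x) = wave (t - s) x := by
  rw [wave_comm t, wave_comm s, wave_mul_conj_wave, wave_comm]

theorem norm_wave_sub_wave_le (t x y : ℝ) : ‖wave t x - wave t y‖ ≤ |t| * |x - y| := by
  have h : wave t x - wave t y = wave t y * (wave t (x - y) - 1) := by
    rw [mul_sub, mul_one, ← wave_mul_conj_wave, mul_comm (wave t x), ← mul_assoc,
      Complex.mul_conj, Complex.normSq_eq_norm_sq, norm_wave]
    simp
  rw [h, norm_mul, norm_wave, one_mul, ← abs_mul, wave, mul_comm _ Complex.I]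
  exact Real.norm_exp_I_mul_ofReal_sub_one_le

theorem integral_wave_eq_sinc (u : ℝ) : ∫ t in (-1 : ℝ)..1, wave t u = 2 * Real.sinc u := by
  rcases eq_or_ne u 0 with rfl | hu
  · simp [wave]
    norm_num
  · have h := intervalIntegral.smul_integral_comp_mul_right (a := -1) (b := 1)
      (fun t : ℝ => Complex.exp (t * Complex.I)) u
    rw [neg_one_mul, one_mul, integral_exp_mul_I_eq_sinc, Complex.real_smul] at h
    refine mul_left_cancel₀ (Complex.ofReal_ne_zero.2 hu) (h.trans ?_)
    ring

theorem integral_wave (x y : ℝ) : ∫ t, wave t (x - y) ∂bandMeasure = sineKernel x y := by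
  rw [bandMeasure, integral_smul_measure, ← intervalIntegral.integral_of_le (by norm_num),
    integral_wave_eq_sinc, sineKernel, ENNReal.toReal_ofReal (by positivity), Complex.real_smul]
  push_cast
  field_simp

theorem memLp_wave (α t : ℝ) : MemLp (wave t) 2 (vol α) :=
  MemLp.of_bound (continuous_wave_right t).aestronglyMeasurable 1
    (Eventually.of_forall fun x => (norm_wave t x).le)

/-- The plane wave `x ↦ e^{itx}` as an element of `L²[0, α]`. -/
noncomputable def planeWave (α t : ℝ) : L2 α := (memLp_wave α t).toLp

theorem inner_planeWave {α : ℝ} (f : L2 α) (t : ℝ) :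
    inner ℂ f (planeWave α t) = ∫ x, wave t x * conj (f x) ∂(vol α) := by
  rw [L2.inner_def]
  refine integral_congr_ae ?_
  filter_upwards [(memLp_wave α t).coeFn_toLp] with x hx
  rw [planeWave, hx, RCLike.inner_apply]

theorem planeWave_inner {α : ℝ} (f : L2 α) (t : ℝ) :
    inner ℂ (planeWave α t) f = ∫ x, f x * conj (wave t x) ∂(vol α) := by
  rw [L2.inner_def]
  refine integral_congr_ae ?_
  filter_upwards [(memLp_wave α t).coeFn_toLp] with x hx
  rw [planeWave, hx, RCLike.inner_apply]

theorem inner_planeWave_planeWave (α s t : ℝ) :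
    inner ℂ (planeWave α s) (planeWave α t) = ∫ x, wave (t - s) x ∂(vol α) := by
  rw [planeWave_inner]
  refine integral_congr_ae ?_
  filter_upwards [(memLp_wave α t).coeFn_toLp] with x hx
  rw [planeWave, hx, wave_mul_conj_wave_left]

theorem norm_planeWave_sq {α : ℝ} (hα : 0 ≤ α) (t : ℝ) : ‖planeWave α t‖ ^ 2 = α := by
  rw [← inner_self_eq_norm_sq (𝕜 := ℂ), inner_planeWave_planeWave]
  simp [wave, measureReal_def, hα]

theorem measurable_inner_planeWave {α : ℝ} (f : L2 α) :
    Measurable fun t => (inner ℂ f (planeWave α t) : ℂ) := by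
  simp only [inner_planeWave]
  refine (StronglyMeasurable.integral_prod_right ?_).measurable
  exact continuous_wave.stronglyMeasurable.mul
    (Complex.continuous_conj.comp_stronglyMeasurable
      ((Lp.stronglyMeasurable f).comp_measurable measurable_snd))

/-- The Fourier representation of the sine kernel and Fubini's theorem. -/
theorem inner_sineOperator {α : ℝ} (f g : L2 α) :
    inner ℂ f (sineOperator α g) =
      ∫ t, inner ℂ f (planeWave α t) * inner ℂ (planeWave α t) g ∂bandMeasure := by
  have hf : Integrable (fun x => conj (f x)) (vol α) :=
    (L2.integrable f).mono (Complex.continuous_conj.comp_aestronglyMeasurable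
      (Lp.aestronglyMeasurable f)) (Eventually.of_forall fun x => by simp)
  have hfg : Integrable (fun p : ℝ × ℝ => conj (f p.1) * g p.2) ((vol α).prod (vol α)) :=
    hf.mul_prod (L2.integrable g)
  have hker : Integrable (fun p : ℝ × ℝ => (sineKernel p.1 p.2 : ℂ) * (conj (f p.1) * g p.2))
      ((vol α).prod (vol α)) := by
    refine hfg.bdd_mul (c := 1)
      (Complex.continuous_ofReal.comp continuous_sineKernel).aestronglyMeasurable
      (Eventually.of_forall fun p => ?_)
    rw [Complex.norm_real]
    exact abs_sineKernel_le _ _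
  have htriple : Integrable (Function.uncurry fun (p : ℝ × ℝ) (t : ℝ) =>
      wave t (p.1 - p.2) * (conj (f p.1) * g p.2)) (((vol α).prod (vol α)).prod bandMeasure) := by
    refine (hfg.comp_fst bandMeasure).bdd_mul (c := 1) ?_
      (Eventually.of_forall fun p => (norm_wave _ _).le)
    exact (continuous_wave.comp (by fun_prop :
      Continuous fun p : (ℝ × ℝ) × ℝ => (p.2, p.1.1 - p.1.2))).aestronglyMeasurable
  calc inner ℂ f (sineOperator α g)
      = ∫ x, ∫ y, (sineKernel x y : ℂ) * (conj (f x) * g y) ∂(vol α) ∂(vol α) := by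
        rw [L2.inner_def]
        refine integral_congr_ae ?_
        filter_upwards [sineOperator_apply α g] with x hx
        rw [hx, RCLike.inner_apply, mul_comm, ← integral_const_mul]
        refine integral_congr_ae (Eventually.of_forall fun y => ?_)
        simp only
        ring
    _ = ∫ p, (sineKernel p.1 p.2 : ℂ) * (conj (f p.1) * g p.2) ∂((vol α).prod (vol α)) :=
        (integral_prod _ hker).symm
    _ = ∫ p, ∫ t, wave t (p.1 - p.2) * (conj (f p.1) * g p.2) ∂bandMeasure
          ∂((vol α).prod (vol α)) := by
        simp only [integral_mul_const, integral_wave]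
    _ = ∫ t, ∫ p, wave t (p.1 - p.2) * (conj (f p.1) * g p.2) ∂((vol α).prod (vol α))
          ∂bandMeasure := integral_integral_swap htriple
    _ = _ := by
        refine integral_congr_ae (Eventually.of_forall fun t => ?_)
        simp only
        rw [inner_planeWave, planeWave_inner, ← integral_prod_mul]
        refine integral_congr_ae (Eventually.of_forall fun p => ?_)
        simp only [← wave_mul_conj_wave]
        ring

theorem isRankOneIntegral_sineOperator {α : ℝ} (hα : 0 ≤ α) :
    IsRankOneIntegral (sineOperator α) bandMeasure (planeWave α) α where
  measurable_inner := measurable_inner_planeWave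
  norm_sq_le t := (norm_planeWave_sq hα t).le
  inner_apply := inner_sineOperator

/-! ### The Toeplitz matrices of an arc -/

/-- The half-open interval `(0, 2π]` contains one angle for each point of the circle, so that the
image under `Circle.exp` in the definition of the arc can be undone. -/
theorem arcIndicator_exp {β θ : ℝ} (hβ : 0 < β) (hθ : θ ∈ Set.Ioc 0 (2 * Real.pi)) :
    arcIndicator β (Circle.exp θ) =
      (Set.Ioo β (2 * Real.pi - β)).indicator (fun _ => (1 : ℂ)) θ := by
  have hiff : Circle.exp θ ∈ Circle.exp '' Set.Ioo β (2 * Real.pi - β) ↔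
      θ ∈ Set.Ioo β (2 * Real.pi - β) := by
    refine ⟨?_, Set.mem_image_of_mem _⟩
    rintro ⟨η, hη, h⟩
    obtain ⟨m, hm⟩ := Circle.exp_eq_exp.1 h
    have hpi := Real.pi_pos
    have h1 : (m : ℝ) < 1 := by
      by_contra! hc
      nlinarith [hη.1, hη.2, hθ.1, hθ.2]
    have h2 : (-1 : ℝ) < m := by
      by_contra! hc
      nlinarith [hη.1, hη.2, hθ.1, hθ.2]
    have h3 : m = 0 := by
      have h1' : m < 1 := by exact_mod_cast h1
      have h2' : -1 < m := by exact_mod_cast h2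
      omega
    rw [h3] at hm
    have h4 : η = θ := by simpa using hm
    exact h4 ▸ hη
  unfold arcIndicator
  by_cases h : θ ∈ Set.Ioo β (2 * Real.pi - β)
  · rw [Set.indicator_of_mem h, Set.indicator_of_mem (hiff.2 h), Pi.one_apply]
  · rw [Set.indicator_of_notMem h, Set.indicator_of_notMem (fun h' => h (hiff.1 h'))]

theorem integral_exp_arc {β : ℝ} (hβ : β ≠ 0) (k : ℤ) :
    ∫ θ in β..(2 * Real.pi - β), Complex.exp (-(Complex.I * k * θ)) =
      (if k = 0 then (2 * Real.pi : ℂ) else 0) - 2 * β * Real.sinc (k * β) := by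
  rcases eq_or_ne k 0 with rfl | hk
  · simp
    ring
  have hkc : (-(Complex.I * k)) ≠ 0 := by simp [hk]
  have hkβ : (k * β : ℝ) ≠ 0 := mul_ne_zero (by exact_mod_cast hk) hβ
  have h := integral_exp_mul_complex (a := β) (b := 2 * Real.pi - β) hkc
  have hper : Complex.exp (-(Complex.I * k) * ((2 * Real.pi - β : ℝ) : ℂ)) =
      Complex.exp ((k * β : ℂ) * Complex.I) := by
    rw [Complex.exp_eq_exp_iff_exists_int]
    exact ⟨-k, by push_cast; ring⟩
  have hneg : Complex.exp (-(Complex.I * k) * (β : ℂ)) = Complex.exp (-(k * β : ℂ) * Complex.I) := by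
    ring_nf
  have hsin : Complex.exp ((k * β : ℂ) * Complex.I) - Complex.exp (-(k * β : ℂ) * Complex.I) =
      2 * Complex.I * Complex.sin (k * β) := by
    rw [Complex.sin]
    linear_combination (-(Complex.exp (-(k * β : ℂ) * Complex.I) -
      Complex.exp ((k * β : ℂ) * Complex.I))) * Complex.I_sq
  rw [hper, hneg, hsin] at h
  simp only [neg_mul, mul_assoc] at h ⊢
  rw [h, if_neg hk, Real.sinc_of_ne_zero hkβ]
  have hβc : (β : ℂ) ≠ 0 := by exact_mod_cast hβ
  have hkc' : (k : ℂ) ≠ 0 := by exact_mod_cast hk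
  push_cast
  field_simp
  ring

theorem circleFourierCoeff_arcIndicator {β : ℝ} (hβ : 0 < β) (hβ' : β ≤ Real.pi) (k : ℤ) :
    circleFourierCoeff (arcIndicator β) k =
      (if k = 0 then 1 else 0) - (β / Real.pi * Real.sinc (k * β) : ℝ) := by
  have hint : ∫ θ in (0 : ℝ)..(2 * Real.pi), arcIndicator β (Circle.exp θ) *
        Complex.exp (-(Complex.I * k * θ)) =
      ∫ θ in β..(2 * Real.pi - β), Complex.exp (-(Complex.I * k * θ)) := by
    rw [intervalIntegral.integral_of_le (by positivity),
      intervalIntegral.integral_of_le (by linarith), integral_Ioc_eq_integral_Ioo (x := β)]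
    have hsub : Set.Ioo β (2 * Real.pi - β) ⊆ Set.Ioc 0 (2 * Real.pi) := fun θ hθ =>
      ⟨hβ.trans hθ.1, by linarith [hθ.2]⟩
    rw [← Set.inter_eq_right.2 hsub, ← setIntegral_indicator measurableSet_Ioo]
    refine setIntegral_congr_fun measurableSet_Ioc fun θ hθ => ?_
    simp only [arcIndicator_exp hβ hθ, Set.indicator_apply]
    split_ifs <;> simp
  have hpi : (Real.pi : ℂ) ≠ 0 := by exact_mod_cast Real.pi_ne_zero
  rw [circleFourierCoeff, hint, integral_exp_arc hβ.ne']
  split_ifs <;> push_cast <;> field_simp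
  ring

/-- The vector `(√(α/n) e^{itjα/n})_j`, the discrete counterpart of the plane wave on `[0, α]`. -/
noncomputable def gridWave (α : ℝ) (n : ℕ) (t : ℝ) : EuclideanSpace ℂ (Fin n) :=
  WithLp.toLp 2 fun j : Fin n => (Real.sqrt (α / n) : ℂ) * wave t (j * (α / n))

theorem measurable_gridWave (α : ℝ) (n : ℕ) : Measurable (gridWave α n) :=
  (PiLp.continuous_toLp 2 _).measurable.comp
    (measurable_pi_lambda _ fun _ => (continuous_const.mul (continuous_wave_left _)).measurable)

theorem sqrt_mul_wave_mul_conj {c : ℝ} (hc : 0 ≤ c) (z w : ℂ) :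
    ((Real.sqrt c : ℂ) * z) * conj ((Real.sqrt c : ℂ) * w) = c * (z * conj w) := by
  rw [map_mul, Complex.conj_ofReal, mul_mul_mul_comm, ← Complex.ofReal_mul, Real.mul_self_sqrt hc]

theorem inner_gridWave {α : ℝ} (hα : 0 ≤ α) (n : ℕ) (s t : ℝ) :
    inner ℂ (gridWave α n s) (gridWave α n t) =
      (α / n : ℝ) * ∑ j ∈ Finset.range n, wave (t - s) (j * (α / n)) := by
  rw [PiLp.inner_apply, Finset.sum_range, Finset.mul_sum]
  refine Finset.sum_congr rfl fun j _ => ?_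
  rw [RCLike.inner_apply, ← wave_mul_conj_wave_left]
  exact sqrt_mul_wave_mul_conj (by positivity) _ _

theorem norm_gridWave_sq_le {α : ℝ} (hα : 0 ≤ α) (n : ℕ) (t : ℝ) : ‖gridWave α n t‖ ^ 2 ≤ α := by
  rw [← inner_self_eq_norm_sq (𝕜 := ℂ), inner_gridWave hα]
  rcases Nat.eq_zero_or_pos n with rfl | hn
  · simpa using hα
  · have : (n : ℂ) ≠ 0 := by exact_mod_cast hn.ne'
    simp [wave, div_mul_cancel₀ _ this]

/-- The entries of `1 - T_n(χ_{α/n})` are `α / n` times the values of the sine kernel on a grid of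
mesh `α / n`. The condition on `n` makes `α / n` an admissible opening angle. -/
theorem toeplitz_arcIndicator {α : ℝ} (hα : 0 < α) {n : ℕ} (hn : α / n ≤ Real.pi) :
    toeplitz n (arcIndicator (α / n)) =
      1 + (-1 : ℂ) • momentMatrix bandMeasure (gridWave α n) := by
  ext j k
  have hnpos : 0 < n := j.pos
  have hβ : 0 < α / n := by positivity
  have hmoment : momentMatrix bandMeasure (gridWave α n) j k =
      ((α / n : ℝ) : ℂ) * sineKernel (j * (α / n)) (k * (α / n)) := by
    rw [← integral_wave, ← integral_const_mul]
    refine integral_congr_ae (Eventually.of_forall fun t => ?_)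
    simp only [← wave_mul_conj_wave]
    exact sqrt_mul_wave_mul_conj hβ.le _ _
  rw [Matrix.add_apply, Matrix.smul_apply, hmoment, toeplitz, Matrix.of_apply,
    circleFourierCoeff_arcIndicator hβ hn, Matrix.one_apply, sineKernel]
  have hjk : ((j : ℤ) - (k : ℤ) = 0) ↔ j = k := by
    rw [sub_eq_zero, Nat.cast_inj, Fin.val_inj]
  simp only [hjk]
  push_cast
  rw [← sub_mul]
  simp only [smul_eq_mul]
  ring

/-- The Riemann sums of a plane wave, with left endpoints, converge to its integral. -/
theorem tendsto_riemannSum_wave {α : ℝ} (hα : 0 ≤ α) (u : ℝ) :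
    Tendsto (fun n : ℕ => ((α / n : ℝ) : ℂ) * ∑ j ∈ Finset.range n, wave u (j * (α / n))) atTop
      (𝓝 (∫ x, wave u x ∂(vol α))) := by
  have hcont := continuous_wave_right u
  have hbound : ∀ n : ℕ, 0 < n →
      ‖((α / n : ℝ) : ℂ) * ∑ j ∈ Finset.range n, wave u (j * (α / n)) -
        ∫ x, wave u x ∂(vol α)‖ ≤ |u| * α ^ 2 / n := by
    intro n hn
    have hn' : (n : ℝ) ≠ 0 := by exact_mod_cast hn.ne'
    have hstep : ∀ j : ℕ, ((j + 1 : ℕ) : ℝ) * (α / n) - j * (α / n) = α / n := fun j => by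
      push_cast
      ring
    have hβ : 0 ≤ α / n := by positivity
    have hadj := intervalIntegral.sum_integral_adjacent_intervals (f := wave u) (μ := volume)
      (a := fun j : ℕ => (j : ℝ) * (α / n)) (n := n)
      (fun k _ => hcont.intervalIntegrable _ _)
    rw [integral_Icc_eq_integral_Ioc, ← intervalIntegral.integral_of_le hα]
    simp only [Nat.cast_zero, zero_mul, mul_div_cancel₀ α hn'] at hadj
    rw [← hadj, Finset.mul_sum, ← Finset.sum_sub_distrib]
    calc _ ≤ ∑ j ∈ Finset.range n, |u| * (α / n) * (α / n) := by
          refine norm_sum_le_of_le _ fun j _ => ?_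
          have hc : ((α / n : ℝ) : ℂ) * wave u (j * (α / n)) =
              ∫ _ in (j * (α / n))..(((j + 1 : ℕ) : ℝ) * (α / n)), wave u (j * (α / n)) := by
            rw [intervalIntegral.integral_const, hstep, Complex.real_smul]
          rw [hc, ← intervalIntegral.integral_sub (by simp) (hcont.intervalIntegrable _ _)]
          refine (intervalIntegral.norm_integral_le_of_norm_le_const (C := |u| * (α / n))
            fun x hx => ?_).trans ?_
          · rw [Set.uIoc_of_le (by linarith [hstep j])] at hx
            refine (norm_wave_sub_wave_le _ _ _).trans ?_
            gcongr
            rw [abs_le]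
            constructor <;> linarith [hstep j, hx.1, hx.2]
          · rw [hstep, abs_of_nonneg hβ]
      _ = |u| * α ^ 2 / n := by
          rw [Finset.sum_const, Finset.card_range, nsmul_eq_mul]
          field_simp
  rw [tendsto_iff_norm_sub_tendsto_zero]
  refine squeeze_zero' (Eventually.of_forall fun _ => norm_nonneg _)
    ((eventually_gt_atTop 0).mono fun n hn => hbound n hn) ?_
  exact tendsto_const_div_atTop_nhds_zero_nat _

end SineKernel

theorem proposition3p1 (α : ℝ) (hα : 0 < α) :
    ∃ d : ℂ, SineKernel.HasOperatorDet (1 - SineKernel.sineOperator α) d ∧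
      Filter.Tendsto
        (fun n : ℕ => (SineKernel.toeplitz n (SineKernel.arcIndicator (α / n))).det)
        Filter.atTop (nhds d) := by
  have : Fact ((2 : ENNReal) ≠ ⊤) := ⟨by simp⟩
  refine ⟨_, (SineKernel.isRankOneIntegral_sineOperator hα.le).hasOperatorDet, ?_⟩
  have hlim := SineKernel.tendsto_det_one_add_smul_momentMatrix (μ := SineKernel.bandMeasure)
    (l := Filter.atTop) (v := SineKernel.gridWave α)
    (g := fun s t => inner ℂ (SineKernel.planeWave α s) (SineKernel.planeWave α t))
    (SineKernel.measurable_gridWave α)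
    (SineKernel.norm_gridWave_sq_le hα.le) (fun s t => by
      simp only [SineKernel.inner_gridWave hα.le, SineKernel.inner_planeWave_planeWave]
      exact SineKernel.tendsto_riemannSum_wave hα.le (t - s)) (-1)
  refine hlim.congr' ?_
  -- The Toeplitz matrix has this form only once `α / n` is at most `π`.
  have hev : ∀ᶠ n : ℕ in Filter.atTop, α / n < Real.pi :=
    (tendsto_const_div_atTop_nhds_zero_nat α).eventually_lt_const Real.pi_pos
  filter_upwards [hev] with n hn
  rw [SineKernel.toeplitz_arcIndicator hα hn.le]
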